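/- Let $\mathcal H$ be a separable complex Hilbert space and let $\mathcal S,\mathcal T$ be closed subspaces of $\mathcal H$. A common complement of $\mathcal S$ and $\mathcal T$ is a closed subspace $\mathcal Z$ with $\mathcal S\dotplus\mathcal Z=\mathcal T\dotplus\mathcal Z=\mathcal H$ (direct, not necessarily orthogonal, sums). Dimensions take values in $\{0,1,2,\dots,\infty\}$. Say that closed subspaces $\mathcal U,\mathcal V$ have bi-orthogonal bases if there are sets $I,J\subseteq\mathbb N$ and orthonormal bases $\{\xi_n:n\in I\}$ of $\mathcal U$ and $\{\psi_n:n\in J\}$ of $\mathcal V$ such that $$\langle\xi_n,\psi_k\rangle=0\quad\text{for all } n\in I,\ k\in J,\ n\neq k,\qquad\text{and}\qquad \langle\xi_n,\psi_n\rangle\to0\quad\text{as } n\to\infty,\ n\in I\cap J$$ (the last condition being void if $I\cap J$ is finite). Then $\mathcal S$ and $\mathcal T$ have no common complement if and only if all of the following hold: 1. $\dim(\mathcal S\cap\mathcal T^\perp)\neq\dim(\mathcal S^\perp\cap\mathcal T)$; 2. if $\dim(\mathcal S\cap\mathcal T^\perp)<\infty$, then $\mathcal S$ and $\mathcal T^\perp$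 have bi-orthogonal bases; 3. if $\dim(\mathcal S^\perp\cap\mathcal T)<\infty$, then $\mathcal S^\perp$ and $\mathcal T$ have bi-orthogonal bases. It is also equivalent that 1 holds and that, for at least one of the two dimensions in 1, this dimension is finite and the corresponding pair ($\mathcal S,\mathcal T^\perp$ for the first, $\mathcal S^\perp,\mathcal T$ for the second) has bi-orthogonal bases. -/

import Mathlib

open Filter Topology

noncomputable section

namespace CommonComplement

variable {H : Type*} [NormedAddCommGroup H] [InnerProductSpace ℂ H]

/-- `S` and `T` have a common complement: a closed subspace `Z` with
`S ∔ Z = T ∔ Z = H` (direct, not necessarily orthogonal, sums). -/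
def HasCommonComplement (S T : Submodule ℂ H) : Prop :=
  ∃ Z : Submodule ℂ H, IsClosed (Z : Set H) ∧ IsCompl S Z ∧ IsCompl T Z

/-- The dimension of a subspace of a separable Hilbert space, with values in `{0, 1, 2, …, ∞}`. -/
def dim (V : Submodule ℂ H) : ℕ∞ :=
  Cardinal.toENat (Module.rank ℂ V)

/-- `U` and `V` have orthonormal (Hilbert) bases `{ξ n : n ∈ I}` and `{ψ n : n ∈ J}`, numbered by
sets `I`, `J` of natural numbers, with `⟪ξ n, ψ k⟫ = 0` for `n ≠ k` and `⟪ξ n, ψ n⟫ → 0` as `n → ∞`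
in `I ∩ J` (no condition if `I ∩ J` is finite). The index sets may differ because `U` and `V` may
have different dimensions, and a basis vector of one of them may have no partner in the other. -/
def HasBiorthogonalBases (U V : Submodule ℂ H) : Prop :=
  ∃ (I J : Set ℕ) (ξ : HilbertBasis I ℂ U) (ψ : HilbertBasis J ℂ V),
    (∀ (n : I) (k : J), (n : ℕ) ≠ (k : ℕ) → inner ℂ (ξ n : H) (ψ k : H) = 0) ∧
    Tendsto (fun n : ↥(I ∩ J) => inner ℂ (ξ ⟨n, n.2.1⟩ : H) (ψ ⟨n, n.2.2⟩ : H))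
      (comap (fun n : ↥(I ∩ J) => (n : ℕ)) atTop) (𝓝 0)

end CommonComplement

end

/-! Let `P`, `Q` be the orthogonal projections onto `S`, `T`. By the singular value decomposition,
closed subspaces `U`, `V` have bi-orthogonal bases exactly when the product of their projections is
compact (`hasBiorthogonalBases_iff_isCompactOperator`). The bases for `S`, `Tᗮ` thus encode
compactness of `(1 - Q)P`.

Obstruction: if `Z` is a common complement, the projection onto `T` along `Z` restricts to an
isomorphism `S → T`. When `(1 - Q)P` is compact, it differs from `Q|S` by a compact operator, so
`Q|S` is Fredholm of index zero. Its kernel is `S ⊓ Tᗮ` and its cokernel is `T ⊓ Sᗮ`, so these have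
equal dimension (`not_hasCommonComplement_of_isCompactOperator`).

Existence: a spectral subspace `L` of `(P - Q)²` for `(δ, ∞)` reduces both projections. On `Lᗮ` the
subspaces are close, so `Q` matches their parts; on `L` they are uniformly transversal, and any
isometry `S ⊓ L ≃ T ⊓ L` yields a complement. Hence `dim (S ⊓ L) = dim (T ⊓ L)` for one `δ` in `(0,
1)` suffices (`hasCommonComplement_of_dim_inf_eq`). Equal defect dimensions force this equality. If
`S ⊓ Tᗮ` is finite dimensional and no complement exists, every `S ⊓ L` is finite dimensional, and
letting `δ → 0` makes `(1 - Q)P` a norm limit of finite rank operators. -/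

namespace CommonComplement

/-! ### Compact operators and the Fredholm alternative -/

section Compact

variable {E F : Type*} [NormedAddCommGroup E] [InnerProductSpace ℂ E] [CompleteSpace E]
  [NormedAddCommGroup F] [InnerProductSpace ℂ F] [CompleteSpace F]

/-- The Hilbert space adjoint of a compact operator is compact. -/
theorem isCompactOperator_adjoint {K : E →L[ℂ] F} (hK : IsCompactOperator K) :
    IsCompactOperator K.adjoint := by
  rw [← ContinuousLinearMap.coe_coe,
    isCompactOperator_iff_isCompact_closure_image_closedBall _ one_pos]
  refine TotallyBounded.isCompact_of_isClosed (TotallyBounded.closure ?_) isClosed_closure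
  have hKK : IsCompactOperator (K ∘L K.adjoint) := hK.comp_clm _
  have htb := (hKK.isCompact_closure_image_closedBall
    (f := ((K ∘L K.adjoint : F →L[ℂ] F) : F →ₗ[ℂ] F)) 1).totallyBounded.subset subset_closure
  rw [Metric.totallyBounded_iff]
  intro ε hε
  -- The net is for `K K*`. Since `‖K*u‖² ≤ ‖K K*u‖ ‖u‖` and differences in the unit ball have norm
  -- at most 2, mesh `ε² / 2` becomes mesh `ε` for `K*`.
  obtain ⟨t, hts, htf, hcov⟩ := Metric.finite_approx_of_totallyBounded htb (ε ^ 2 / 2) (by positivity)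
  obtain ⟨t', ht's, ht'f, rfl⟩ := Set.exists_subset_image_finite_and.1 ⟨t, hts, htf, rfl⟩
  refine ⟨K.adjoint '' t', ht'f.image _, ?_⟩
  rintro _ ⟨y, hy, rfl⟩
  obtain ⟨_, ⟨z, hz, rfl⟩, hyz⟩ := Set.mem_iUnion₂.1 (hcov ⟨y, hy, rfl⟩)
  refine Set.mem_iUnion₂.2 ⟨_, ⟨z, hz, rfl⟩, ?_⟩
  have hz' := ht's hz
  rw [mem_closedBall_zero_iff] at hy hz'
  rw [mem_ball_iff_norm] at hyz ⊢
  have h1 : ‖K.adjoint (y - z)‖ ^ 2 ≤ ‖K (K.adjoint (y - z))‖ * ‖y - z‖ := by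
    rw [← @inner_self_eq_norm_sq ℂ, ContinuousLinearMap.adjoint_inner_right]
    exact (RCLike.re_le_norm _).trans (norm_inner_le_norm _ _)
  have h2 : ‖y - z‖ ≤ 2 := (norm_sub_le _ _).trans (by linarith)
  have h3 : ‖K (K.adjoint (y - z))‖ < ε ^ 2 / 2 := by simpa using hyz
  have h4 : ‖K.adjoint (y - z)‖ ^ 2 < ε ^ 2 := by
    nlinarith [mul_le_mul_of_nonneg_left h2 (norm_nonneg (K (K.adjoint (y - z))))]
  simpa using lt_of_pow_lt_pow_left₀ 2 hε.le h4

/-- Fredholm alternative at the point 1: it is either an eigenvalue or in the resolvent set. -/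
theorem surjective_one_sub_of_injective {K : E →L[ℂ] E} (hK : IsCompactOperator K)
    (hinj : ∀ x, K x = x → x = 0) : Function.Surjective (1 - K : E →L[ℂ] E) := by
  rcases hK.hasEigenvalue_or_mem_resolventSet (one_ne_zero (α := ℂ)) with h | h
  · obtain ⟨x, hx⟩ := h.exists_hasEigenvector
    exact absurd (hinj x (by simpa using hx.apply_eq_smul)) hx.2
  · rw [spectrum.mem_resolventSet_iff, ContinuousLinearMap.isUnit_iff_bijective] at h
    simpa using h.2

omit [CompleteSpace F] in
/-- A compact perturbation of an isomorphism is surjective as soon as it is injective. -/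
theorem surjective_of_injective_of_isCompactOperator_sub (A : E ≃L[ℂ] F) {C : E →L[ℂ] F}
    (hK : IsCompactOperator ((A : E →L[ℂ] F) - C)) (hinj : Function.Injective C) :
    Function.Surjective C := by
  have hK' : IsCompactOperator ((A.symm : F →L[ℂ] E) ∘L ((A : E →L[ℂ] F) - C)) :=
    hK.clm_comp (A.symm : F →L[ℂ] E)
  have hs := surjective_one_sub_of_injective hK' (fun x hx => by
    apply hinj
    simpa using hx)
  intro y
  obtain ⟨x, hx⟩ := hs (A.symm y)
  exact ⟨x, A.symm.injective (by simpa using hx)⟩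

/-- A compact perturbation of an isomorphism has surjective adjoint as soon as the adjoint is
injective. -/
theorem adjoint_surjective_of_injective_of_isCompactOperator_sub (A : E ≃L[ℂ] F) {C : E →L[ℂ] F}
    (hK : IsCompactOperator ((A : E →L[ℂ] F) - C)) (hinj : Function.Injective C.adjoint) :
    Function.Surjective C.adjoint := by
  let B : F →L[ℂ] E := A.symm
  have hB : (A : E →L[ℂ] F) ∘L B = 1 := by ext; simp [B]
  have hB2 : B ∘L (A : E →L[ℂ] F) = 1 := by ext; simp [B]
  have h1 : (A : E →L[ℂ] F).adjoint ∘L B.adjoint = 1 := by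
    rw [← ContinuousLinearMap.adjoint_comp, hB2]; exact star_one _
  have hK' : IsCompactOperator (B ∘L ((A : E →L[ℂ] F) - C)) := hK.clm_comp B
  have hK'' := isCompactOperator_adjoint hK'
  -- Adjoints reverse the order, so the alternative applies to `C* B*`; its surjectivity passes to
  -- the left factor `C*`.
  have h2 : (B ∘L ((A : E →L[ℂ] F) - C)).adjoint = 1 - C.adjoint ∘L B.adjoint := by
    rw [ContinuousLinearMap.adjoint_comp, map_sub, ContinuousLinearMap.sub_comp, h1]
  rw [h2] at hK''
  have hs := surjective_one_sub_of_injective hK'' (fun x hx => by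
    have h3 : B.adjoint x = 0 := hinj (by simpa using hx)
    have := congrArg (fun f => f x) h1
    simpa [h3] using this.symm)
  intro y
  obtain ⟨x, hx⟩ := hs y
  exact ⟨B.adjoint x, by simpa using hx⟩

omit [CompleteSpace E] [CompleteSpace F] in
theorem isCompactOperator_of_finiteDimensional_range {K : E →L[ℂ] F} {G : Submodule ℂ F}
    [FiniteDimensional ℂ G] (h : ∀ x, K x ∈ G) : IsCompactOperator K := by
  have : IsCompactOperator (G.subtypeL ∘L K.codRestrict G h) :=
    (isCompactOperator_of_locallyCompactSpace_dom (K.codRestrict G h)).clm_comp G.subtypeL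
  exact this

omit [CompleteSpace E] [CompleteSpace F] in
theorem isCompactOperator_of_finiteDimensional_dom (G : Type*) [NormedAddCommGroup G]
    [InnerProductSpace ℂ G] [FiniteDimensional ℂ G] (B : G →L[ℂ] F) (K : E →L[ℂ] G) :
    IsCompactOperator (B ∘L K) :=
  have := FiniteDimensional.proper ℂ G
  (isCompactOperator_of_locallyCompactSpace_dom K).clm_comp B

omit [CompleteSpace E] in
/-- A norm limit of compact operators is compact. -/
theorem isCompactOperator_of_forall_exists_norm_sub_le {K : E →L[ℂ] F}
    (h : ∀ ε > 0, ∃ K' : E →L[ℂ] F, IsCompactOperator K' ∧ ∀ x, ‖K x - K' x‖ ≤ ε * ‖x‖) :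
    IsCompactOperator K := by
  have hc := isClosed_setOfPred_isCompactOperator (σ₁₂ := RingHom.id ℂ) (M₁ := E) (M₂ := F)
  refine hc.closure_subset (Metric.mem_closure_iff.2 fun ε hε => ?_)
  obtain ⟨K', hK', hle⟩ := h (ε / 2) (by positivity)
  refine ⟨K', hK', ?_⟩
  rw [dist_eq_norm]
  refine lt_of_le_of_lt (ContinuousLinearMap.opNorm_le_bound _ (by positivity) fun x => ?_)
    (half_lt_self hε)
  simpa using hle x

end Compact

/-! ### Dimensions and Hilbert bases in separable spaces -/

section Dimension

variable {H : Type*} [NormedAddCommGroup H] [InnerProductSpace ℂ H]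

theorem dim_lt_top_iff {V : Submodule ℂ H} : dim V < ⊤ ↔ FiniteDimensional ℂ V := by
  rw [dim, Cardinal.toENat_lt_top]
  exact Module.rank_lt_aleph0_iff

theorem dim_eq_finrank (V : Submodule ℂ H) [FiniteDimensional ℂ V] :
    dim V = Module.finrank ℂ V := by
  rw [dim, ← Module.finrank_eq_rank]; simp

theorem dim_le_of_injective {U V : Submodule ℂ H} (f : U →ₗ[ℂ] V) (hf : Function.Injective f) :
    dim U ≤ dim V :=
  OrderHomClass.mono Cardinal.toENat (LinearMap.rank_le_of_injective f hf)

theorem exists_injective_not_surjective_of_dim_lt {U V : Submodule ℂ H} (h : dim U < dim V) :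
    FiniteDimensional ℂ U ∧
      ∃ j : U →ₗ[ℂ] V, Function.Injective j ∧ ∃ v, ∀ u, j u ≠ v := by
  have hU : FiniteDimensional ℂ U := dim_lt_top_iff.1 (h.trans_le le_top)
  refine ⟨hU, ?_⟩
  have hle : Module.rank ℂ U ≤ Module.rank ℂ V := by
    by_contra hlt
    exact absurd (OrderHomClass.mono Cardinal.toENat (not_le.1 hlt).le) (not_le.2 h)
  obtain ⟨j, hj⟩ := rank_le_iff_exists_linearMap.1 hle
  refine ⟨j, hj, ?_⟩
  by_contra! hs
  have := (LinearEquiv.ofBijective j ⟨hj, hs⟩).rank_eq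
  rw [dim, dim, this] at h
  exact lt_irrefl _ h

variable {E F : Type*} [NormedAddCommGroup E] [InnerProductSpace ℂ E]
  [NormedAddCommGroup F] [InnerProductSpace ℂ F]

/-- Orthonormal vectors are `√2` apart, so balls of radius `1 / 2` around them are disjoint. -/
theorem countable_of_orthonormal [TopologicalSpace.SeparableSpace E] {ι : Type*} {v : ι → E}
    (hv : Orthonormal ℂ v) : Countable ι := by
  refine Pairwise.countable_of_isOpen_disjoint (s := fun i => Metric.ball (v i) (1 / 2)) ?_
    (fun i => Metric.isOpen_ball) (fun i => ⟨v i, Metric.mem_ball_self (by norm_num)⟩)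
  intro i j hij
  refine Metric.ball_disjoint_ball ?_
  have h : ‖v i - v j‖ ^ 2 = 2 := by
    rw [@norm_sub_sq ℂ, hv.1, hv.1, hv.2 hij]; norm_num
  rw [dist_eq_norm]
  nlinarith [norm_nonneg (v i - v j)]

/-- Reindexing of a Hilbert basis. -/
theorem exists_hilbertBasis_reindex [CompleteSpace E] {ι κ : Type*} (b : HilbertBasis ι ℂ E)
    (e : κ ≃ ι) : ∃ b' : HilbertBasis κ ℂ E, ∀ i, b' i = b (e i) := by
  refine ⟨HilbertBasis.mk (b.orthonormal.comp e e.injective) ?_, fun i => ?_⟩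
  · rw [e.surjective.range_comp, b.dense_span]
  · rw [HilbertBasis.coe_mk]; rfl

theorem exists_hilbertBasis_nat [CompleteSpace E] [TopologicalSpace.SeparableSpace E]
    (h : ¬ FiniteDimensional ℂ E) : Nonempty (HilbertBasis ℕ ℂ E) := by
  obtain ⟨w, b, hb⟩ := exists_hilbertBasis ℂ E
  have := countable_of_orthonormal b.orthonormal
  have : Infinite w := by
    by_contra hfin
    rw [not_infinite_iff_finite] at hfin
    have := Fintype.ofFinite w
    exact h b.toOrthonormalBasis.toBasis.finiteDimensional_of_finite
  have := Encodable.ofCountable w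
  have := Denumerable.ofEncodableOfInfinite w
  obtain ⟨b', -⟩ := exists_hilbertBasis_reindex b (Denumerable.eqv w).symm
  exact ⟨b'⟩

/-- Closed subspaces of equal dimension of a separable Hilbert space are isometric. -/
theorem nonempty_linearIsometryEquiv_of_dim_eq [TopologicalSpace.SeparableSpace H]
    {U V : Submodule ℂ H} [CompleteSpace U] [CompleteSpace V] (h : dim U = dim V) :
    Nonempty (U ≃ₗᵢ[ℂ] V) := by
  by_cases hU : FiniteDimensional ℂ U
  · have hV : FiniteDimensional ℂ V := dim_lt_top_iff.1 (h ▸ dim_lt_top_iff.2 hU)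
    rw [dim_eq_finrank, dim_eq_finrank, Nat.cast_inj] at h
    exact ⟨(stdOrthonormalBasis ℂ U).equiv (stdOrthonormalBasis ℂ V) (finCongr h)⟩
  · have hV : ¬ FiniteDimensional ℂ V := fun hV => hU (dim_lt_top_iff.1 (h ▸ dim_lt_top_iff.2 hV))
    obtain ⟨b⟩ := exists_hilbertBasis_nat hU
    obtain ⟨b'⟩ := exists_hilbertBasis_nat hV
    exact ⟨b.repr.trans b'.repr.symm⟩

end Dimension

universe u

/-! ### Bi-orthogonal bases and compactness of the product of projections -/

section Biorthogonal

variable {H : Type*} [NormedAddCommGroup H] [InnerProductSpace ℂ H]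

theorem HasBiorthogonalBases.symm {U V : Submodule ℂ H} (h : HasBiorthogonalBases U V) :
    HasBiorthogonalBases V U := by
  obtain ⟨I, J, ξ, ψ, h1, h2⟩ := h
  refine ⟨J, I, ψ, ξ, fun n k hnk => inner_eq_zero_symm.1 (h1 k n hnk.symm), ?_⟩
  have h3 : Tendsto (fun n : ↥(J ∩ I) => (⟨n, n.2.2, n.2.1⟩ : ↥(I ∩ J)))
      (comap (fun n : ↥(J ∩ I) => (n : ℕ)) atTop)
      (comap (fun n : ↥(I ∩ J) => (n : ℕ)) atTop) :=
    tendsto_comap_iff.2 tendsto_comap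
  have h4 := (Complex.continuous_conj.tendsto 0).comp (h2.comp h3)
  rw [map_zero] at h4
  exact h4.congr fun n => by simp

theorem hasBiorthogonalBases_comm {U V : Submodule ℂ H} :
    HasBiorthogonalBases U V ↔ HasBiorthogonalBases V U :=
  ⟨HasBiorthogonalBases.symm, HasBiorthogonalBases.symm⟩

/-- Parseval's identity, with the basis extended by zero to all natural numbers. -/
theorem hasSum_extend_norm_inner_sq {V : Submodule ℂ H} {J : Set ℕ}
    (ψ : HilbertBasis J ℂ V) (y : V) :
    HasSum (Function.extend (Subtype.val : J → ℕ) (fun k => ‖inner ℂ (ψ k) y‖ ^ 2) 0)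
      (‖y‖ ^ 2) := by
  rw [hasSum_extend_zero Subtype.val_injective]
  have h := ψ.hasSum_inner_mul_inner y y
  rw [inner_self_eq_norm_sq_to_K] at h
  have h' := RCLike.hasSum_re ℂ h
  convert! h' using 1
  · ext k
    rw [← inner_conj_symm, RCLike.norm_conj, RCLike.mul_conj]
    norm_cast
  · norm_cast

/-- The product is diagonal in the two bases, with entries tending to zero; truncation at index `N`
leaves finite rank and an error at most `ε`. -/
theorem HasBiorthogonalBases.isCompactOperator [CompleteSpace H] {U V : Submodule ℂ H}
    [CompleteSpace U] [CompleteSpace V] (h : HasBiorthogonalBases U V) :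
    IsCompactOperator (V.starProjection ∘L U.starProjection) := by
  obtain ⟨I, J, ξ, ψ, hort, hlim⟩ := h
  have hproj : ∀ (k : J) (n : I), (n : ℕ) ≠ k →
      inner ℂ (ξ n) (U.orthogonalProjectionOnto (ψ k)) = 0 := fun k n hnk => by
    rw [Submodule.inner_orthogonalProjectionOnto_eq_of_mem_left]
    exact hort n k hnk
  have hzero : ∀ k : J, (k : ℕ) ∉ I → U.orthogonalProjectionOnto (ψ k) = 0 := fun k hk => by
    refine ξ.repr.injective (lp.ext (funext fun n => ?_))
    rw [ξ.repr_apply_apply, hproj k n fun h => hk (h ▸ n.2)]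
    simp
  have hmul : ∀ (k : J) (hk : (k : ℕ) ∈ I), U.orthogonalProjectionOnto (ψ k) =
      inner ℂ (ξ ⟨k, hk⟩ : H) (ψ k : H) • ξ ⟨k, hk⟩ := fun k hk => by
    refine ξ.repr.injective (lp.ext (funext fun n => ?_))
    rw [ξ.repr_apply_apply, ξ.repr_apply_apply, inner_smul_right]
    by_cases hn : (n : ℕ) = k
    · obtain rfl : n = ⟨k, hk⟩ := Subtype.ext hn
      rw [Submodule.inner_orthogonalProjectionOnto_eq_of_mem_left,
        inner_self_eq_norm_sq_to_K, ξ.orthonormal.1]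
      simp
    · rw [hproj k n hn, ξ.orthonormal.2 fun h => hn (by rw [h])]
      simp
  refine isCompactOperator_of_forall_exists_norm_sub_le fun ε hε => ?_
  obtain ⟨N, hN⟩ : ∃ N : ℕ, ∀ n : ↥(I ∩ J), N ≤ n →
      ‖inner ℂ (ξ ⟨n, n.2.1⟩ : H) (ψ ⟨n, n.2.2⟩ : H)‖ ≤ ε := by
    have h1 := hlim.norm.eventually (Iic_mem_nhds (by simpa using hε : ‖(0 : ℂ)‖ < ε))
    rw [eventually_comap] at h1
    obtain ⟨N, hN⟩ := eventually_atTop.1 h1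
    exact ⟨N, fun n hn => hN n hn n rfl⟩
  let G : Submodule ℂ H := Submodule.span ℂ ((fun n : I => (ξ n : H)) '' {n | (n : ℕ) < N})
  have hfin : ((fun n : I => (ξ n : H)) '' {n | (n : ℕ) < N}).Finite :=
    ((Set.finite_Iio N).preimage Subtype.val_injective.injOn).image _
  have : FiniteDimensional ℂ G := FiniteDimensional.span_of_finite ℂ hfin
  have hGU : G ≤ U := Submodule.span_le.2 (by rintro _ ⟨n, -, rfl⟩; exact (ξ n).2)
  refine ⟨V.starProjection ∘L G.starProjection, ?_, fun x => ?_⟩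
  · exact isCompactOperator_of_finiteDimensional_dom G
      (V.starProjection ∘L G.subtypeL) G.orthogonalProjectionOnto
  -- `y` is the tail of `x` in `U`: only its coefficients of index at least `N` survive, where the
  -- diagonal entries are at most `ε`.
  · let y : U := ⟨U.starProjection x - G.starProjection x, U.sub_mem
      (U.starProjection_apply_mem x) (hGU (G.starProjection_apply_mem x))⟩
    have hy : ∀ n : I, (n : ℕ) < N → inner ℂ (ξ n) y = 0 := fun n hn => by
      have hnG : (ξ n : H) ∈ G := Submodule.subset_span ⟨n, hn, rfl⟩
      change inner ℂ (ξ n : H) (U.starProjection x - G.starProjection x) = 0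
      rw [inner_sub_right, ← Submodule.inner_starProjection_left_eq_right,
        ← Submodule.inner_starProjection_left_eq_right,
        Submodule.starProjection_eq_self_iff.2 hnG,
        Submodule.starProjection_eq_self_iff.2 (ξ n).2, sub_self]
    have hyx : ‖y‖ ≤ ‖x‖ := by
      have h1 : (y : H) = U.starProjection (x - G.starProjection x) := by
        rw [map_sub, Submodule.starProjection_eq_self_iff.2 (hGU (G.starProjection_apply_mem x))]
      have h2 : x - G.starProjection x = Gᗮ.starProjection x := by
        rw [Submodule.starProjection_orthogonal_val]
      change ‖(y : H)‖ ≤ _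
      rw [h1, h2]
      exact (U.norm_starProjection_apply_le _).trans (Gᗮ.norm_starProjection_apply_le _)
    have h1 := hasSum_extend_norm_inner_sq ψ (V.orthogonalProjectionOnto (y : H))
    have h2 := (hasSum_extend_norm_inner_sq ξ y).mul_left (ε ^ 2)
    have h3 : ‖V.orthogonalProjectionOnto (y : H)‖ ^ 2 ≤ ε ^ 2 * ‖y‖ ^ 2 := by
      refine hasSum_le (fun k => ?_) h1 h2
      by_cases hkJ : k ∈ J
      · lift k to J using hkJ
        rw [Subtype.val_injective.extend_apply,
          Submodule.inner_orthogonalProjectionOnto_eq_of_mem_left,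
          ← Submodule.inner_orthogonalProjectionOnto_eq_of_mem_right]
        by_cases hkI : (k : ℕ) ∈ I
        · have h4 : Function.extend (Subtype.val : I → ℕ) (fun k => ‖inner ℂ (ξ k) y‖ ^ 2) 0 k =
              ‖inner ℂ (ξ ⟨k, hkI⟩) y‖ ^ 2 :=
            Subtype.val_injective.extend_apply _ _ (⟨k, hkI⟩ : I)
          rw [h4, hmul k hkI, inner_smul_left, norm_mul, mul_pow, RCLike.norm_conj]
          by_cases hkN : (k : ℕ) < N
          · rw [hy ⟨k, hkI⟩ hkN]; simp
          · gcongr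
            exact hN ⟨k, hkI, k.2⟩ (not_lt.1 hkN)
        · rw [hzero k hkI, inner_zero_left, norm_zero]
          refine (zero_pow two_ne_zero).trans_le (mul_nonneg (sq_nonneg _) ?_)
          rw [Function.extend_apply' _ _ _ (by rintro ⟨n, hn⟩; exact hkI (hn ▸ n.2))]
          rfl
      · rw [Function.extend_apply' _ _ _ (by rintro ⟨n, hn⟩; exact hkJ (hn ▸ n.2))]
        refine mul_nonneg (sq_nonneg _) ?_
        by_cases hkI : k ∈ I
        · lift k to I using hkI
          rw [Subtype.val_injective.extend_apply]; positivity
        · rw [Function.extend_apply' _ _ _ (by rintro ⟨n, hn⟩; exact hkI (hn ▸ n.2))]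
          rfl
    rw [← mul_pow] at h3
    have h5 := le_of_sq_le_sq h3 (by positivity)
    calc _ = ‖V.orthogonalProjectionOnto (y : H)‖ := by
          rw [ContinuousLinearMap.comp_apply, ContinuousLinearMap.comp_apply, ← map_sub]; rfl
      _ ≤ ε * ‖x‖ := h5.trans (by gcongr)

/-- An orthonormal basis of eigenvectors of a compact self-adjoint operator. -/
theorem exists_hilbertBasis_eigenvectors {E : Type u} [NormedAddCommGroup E]
    [InnerProductSpace ℂ E] [CompleteSpace E] {A : E →L[ℂ] E} (hA : IsCompactOperator A)
    (hs : A.IsSymmetric) :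
    ∃ (ι : Type u) (b : HilbertBasis ι ℂ E), ∀ i, ∃ μ : ℂ, A (b i) = μ • b i := by
  let V : ℂ → Submodule ℂ E := fun μ => Module.End.eigenspace (A : Module.End ℂ E) μ
  have hV : ∀ μ x, x ∈ V μ ↔ A x = μ • x := fun μ x => Module.End.mem_eigenspace_iff
  have hort : OrthogonalFamily ℂ (fun μ => V μ) fun μ => (V μ).subtypeₗᵢ :=
    hs.orthogonalFamily_eigenspaces
  have htop : (⨆ μ, V μ)ᗮ = ⊥ :=
    ContinuousLinearMap.orthogonalComplement_iSup_eigenspaces_eq_bot hA hs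
  clear_value V
  have hcl : ∀ μ : ℂ, IsClosed (V μ : Set E) := fun μ => by
    have : (V μ : Set E) = {x | A x = μ • x} := by
      ext x; exact hV μ x
    rw [this]
    exact isClosed_eq A.continuous (continuous_const_smul μ)
  have := fun μ => (hcl μ).completeSpace_coe
  choose w b hb using fun μ : ℂ => exists_hilbertBasis ℂ (V μ)
  have hon : Orthonormal ℂ (fun a : Σ μ, w μ => ((b a.1 a.2 : V a.1) : E)) :=
    hort.orthonormal_sigma_orthonormal (fun μ => (b μ).orthonormal)
  have hbot : (Submodule.span ℂ (Set.range fun a : Σ μ, w μ => ((b a.1 a.2 : V a.1) : E)))ᗮ = ⊥ := by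
    rw [eq_bot_iff, ← htop, ← Submodule.iInf_orthogonal, le_iInf_iff]
    intro μ x hx
    rw [Submodule.mem_orthogonal] at hx ⊢
    intro u hu
    have h0 : (V μ).orthogonalProjectionOnto x = 0 := by
      refine (b μ).repr.injective (lp.ext (funext fun n => ?_))
      rw [(b μ).repr_apply_apply, Submodule.inner_orthogonalProjectionOnto_eq_of_mem_left,
        hx _ (Submodule.subset_span ⟨⟨μ, n⟩, rfl⟩)]
      simp
    have := Submodule.inner_orthogonalProjectionOnto_eq_of_mem_left (K := V μ) ⟨u, hu⟩ x
    rw [h0, inner_zero_right] at this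
    exact this.symm
  refine ⟨Σ μ, w μ, HilbertBasis.mkOfOrthogonalEqBot hon hbot, fun a => ⟨a.1, ?_⟩⟩
  rw [HilbertBasis.coe_mkOfOrthogonalEqBot]
  exact (hV _ _).1 (b a.1 a.2).2

/-- Orthogonal images of norm at least `ε` are `ε`-separated, so infinitely many of them would have
no Cauchy subsequence. -/
theorem finite_setOf_le_norm_of_isCompactOperator {E F : Type*} [NormedAddCommGroup E]
    [InnerProductSpace ℂ E] [NormedAddCommGroup F] [InnerProductSpace ℂ F] {K : E →L[ℂ] F}
    (hK : IsCompactOperator K) {ι : Type*} {e : ι → E} (he : ∀ i, ‖e i‖ ≤ 1)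
    (hort : Pairwise fun i j => inner ℂ (K (e i)) (K (e j)) = 0) {ε : ℝ} (hε : 0 < ε) :
    {i | ε ≤ ‖K (e i)‖}.Finite := by
  by_contra hinf
  have hinf : {i | ε ≤ ‖K (e i)‖}.Infinite := hinf
  obtain ⟨C, hC, hsub⟩ := hK.image_closedBall_subset_compact
    (f := (K : E →ₗ[ℂ] F)) 1
  let f := hinf.natEmbedding
  obtain ⟨y, -, φ, hφ, hlim⟩ := hC.tendsto_subseq (x := fun n => K (e (f n)))
    (fun n => hsub ⟨e (f n), by simpa using he _, rfl⟩)
  obtain ⟨N, hN⟩ := Metric.cauchySeq_iff'.1 hlim.cauchySeq ε hε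
  have h1 := hN (N + 1) (Nat.le_succ N)
  have hne : (f (φ (N + 1)) : ι) ≠ f (φ N) := fun h => by
    have := hφ.injective (f.injective (Subtype.ext h))
    omega
  have h2 := hort hne
  have h3 : ‖K (e (f (φ (N + 1)))) - K (e (f (φ N)))‖ ^ 2 =
      ‖K (e (f (φ (N + 1))))‖ ^ 2 + ‖K (e (f (φ N)))‖ ^ 2 := by
    rw [@norm_sub_sq ℂ, h2]; simp
  have h4 : ε ≤ ‖K (e (f (φ (N + 1))))‖ := (f (φ (N + 1))).2
  rw [dist_eq_norm] at h1
  simp only [Function.comp_apply] at h1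
  nlinarith [norm_nonneg (K (e (f (φ (N + 1)))) - K (e (f (φ N)))), sq_nonneg ‖K (e (f (φ N)))‖]

/-- Singular value decomposition of `K : U → V`: an eigenbasis of `K* K` has orthogonal images,
whose nonzero members are normalised and extended to a basis of `V`. -/
theorem hasBiorthogonalBases_of_isCompactOperator [CompleteSpace H]
    [TopologicalSpace.SeparableSpace H] {U V : Submodule ℂ H}
    [CompleteSpace U] [CompleteSpace V]
    (h : IsCompactOperator (V.starProjection ∘L U.starProjection)) :
    HasBiorthogonalBases U V := by
  let K : U →L[ℂ] V := V.orthogonalProjectionOnto ∘L U.subtypeL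
  have hK : IsCompactOperator K := by
    have h1 : IsCompactOperator (V.orthogonalProjectionOnto ∘L
        ((V.starProjection ∘L U.starProjection) ∘L U.subtypeL)) :=
      (h.comp_clm U.subtypeL).clm_comp V.orthogonalProjectionOnto
    convert! h1 using 2
    ext x
    simp [K, Submodule.starProjection_eq_self_iff.2 (V.starProjection_apply_mem (x : H))]
  have hinner : ∀ (x : U) (y : V), inner ℂ (x : H) (y : H) = inner ℂ (K x) y := fun x y => by
    simp [K]
  have hA : IsCompactOperator (K.adjoint ∘L K) := hK.clm_comp K.adjoint
  have hs : (K.adjoint ∘L K).IsSymmetric := fun x y => by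
    simp [ContinuousLinearMap.adjoint_inner_left, ContinuousLinearMap.adjoint_inner_right]
  obtain ⟨ι, e, he⟩ := exists_hilbertBasis_eigenvectors hA hs
  have hort : Pairwise fun i j => inner ℂ (K (e i)) (K (e j)) = 0 := fun i j hij => by
    obtain ⟨μ, hμ⟩ := he j
    rw [← ContinuousLinearMap.adjoint_inner_right, ← ContinuousLinearMap.comp_apply, hμ,
      inner_smul_right, e.orthonormal.2 hij, mul_zero]
  let ψ : {i // K (e i) ≠ 0} → V := fun i => ((‖K (e i)‖⁻¹ : ℝ) : ℂ) • K (e i)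
  have hψ : Orthonormal ℂ ψ := by
    refine ⟨fun i => ?_, fun i j hij => ?_⟩
    · simp [ψ, norm_smul, i.2]
    · change inner ℂ (_ • K (e i)) (_ • K (e j)) = 0
      rw [inner_smul_left, inner_smul_right, hort (fun h => hij (Subtype.ext h)), mul_zero,
        mul_zero]
  obtain ⟨w, b, hw, hb⟩ := hψ.toSubtypeRange.exists_hilbertBasis_extension
  have := countable_of_orthonormal e.orthonormal
  have := countable_of_orthonormal b.orthonormal
  obtain ⟨c, hc⟩ := exists_injective_nat (w ⊕ ι)
  classical
  -- Numbering of the bases: `e i` takes the label of its normalised image if there is one, and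
  -- otherwise a label that no vector of `V` uses.
  let f₀ : ι → w ⊕ ι := fun i =>
    if hi : K (e i) ≠ 0 then Sum.inl ⟨ψ ⟨i, hi⟩, hw ⟨_, rfl⟩⟩ else Sum.inr i
  have hf₀ : Function.Injective f₀ := fun i j hij => by
    by_cases hi : K (e i) = 0 <;> by_cases hj : K (e j) = 0
    · simpa [f₀, hi, hj] using hij
    · simp [f₀, hi, hj] at hij
    · simp [f₀, hi, hj] at hij
    · simp only [f₀, hi, hj, ne_eq, not_false_eq_true, dite_true, Sum.inl.injEq,
        Subtype.mk.injEq] at hij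
      simpa using hψ.linearIndependent.injective hij
  have hmatch : ∀ (i : ι) (v : w), f₀ i ≠ Sum.inl v → inner ℂ (e i : H) ((b v : V) : H) = 0 := by
    intro i v hiv
    rw [hinner]
    by_cases hi : K (e i) = 0
    · rw [hi, inner_zero_left]
    · have h1 : K (e i) = (‖K (e i)‖ : ℂ) • b ⟨ψ ⟨i, hi⟩, hw ⟨_, rfl⟩⟩ := by
        simp [hb, ψ, smul_smul, hi]
      have h2 : (⟨ψ ⟨i, hi⟩, hw ⟨_, rfl⟩⟩ : w) ≠ v := fun h => hiv (by simp [f₀, hi, h])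
      rw [h1, inner_smul_left, b.orthonormal.2 h2, mul_zero]
  let f : ι → ℕ := fun i => c (f₀ i)
  let g : w → ℕ := fun v => c (Sum.inl v)
  have hf : Function.Injective f := hc.comp hf₀
  have hg : Function.Injective g := hc.comp Sum.inl_injective
  obtain ⟨ξ', hξ'⟩ := exists_hilbertBasis_reindex e (Equiv.ofInjective f hf).symm
  obtain ⟨b', hb'⟩ := exists_hilbertBasis_reindex b (Equiv.ofInjective g hg).symm
  have hfval : ∀ n : Set.range f, f ((Equiv.ofInjective f hf).symm n) = n := fun n =>
    Equiv.apply_ofInjective_symm hf n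
  have hgval : ∀ n : Set.range g, g ((Equiv.ofInjective g hg).symm n) = n := fun n =>
    Equiv.apply_ofInjective_symm hg n
  refine ⟨Set.range f, Set.range g, ξ', b', fun n k hnk => ?_, ?_⟩
  · rw [hξ', hb']
    refine hmatch _ _ fun h => hnk ?_
    rw [← hfval, ← hgval]
    exact congrArg c h
  · rw [Metric.tendsto_nhds]
    intro ε hε
    have hfin := finite_setOf_le_norm_of_isCompactOperator hK (fun i => (e.orthonormal.1 i).le)
      hort hε
    obtain ⟨N, hN⟩ := (hfin.image f).bddAbove
    rw [eventually_comap]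
    filter_upwards [eventually_gt_atTop N]
    rintro _ hn m rfl
    rw [dist_zero_right, hξ', hb', hinner]
    refine (norm_inner_le_norm _ _).trans_lt ?_
    rw [b.orthonormal.1, mul_one]
    by_contra! hle
    have := hN ⟨_, hle, rfl⟩
    rw [hfval] at this
    exact absurd hn (not_lt.2 this)

theorem hasBiorthogonalBases_iff_isCompactOperator [CompleteSpace H]
    [TopologicalSpace.SeparableSpace H] {U V : Submodule ℂ H}
    [CompleteSpace U] [CompleteSpace V] :
    HasBiorthogonalBases U V ↔ IsCompactOperator (V.starProjection ∘L U.starProjection) :=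
  ⟨HasBiorthogonalBases.isCompactOperator, hasBiorthogonalBases_of_isCompactOperator⟩

end Biorthogonal

/-! ### Compactness and unequal defects exclude a common complement -/

section Obstruction

variable {H : Type*} [NormedAddCommGroup H] [InnerProductSpace ℂ H] [CompleteSpace H]

omit [CompleteSpace H] in
theorem starProjection_eq_zero_of_mem_orthogonal {S T : Submodule ℂ H} [CompleteSpace T] {s : H}
    (hs : s ∈ S) (h : T.starProjection s ∈ Sᗮ) : T.starProjection s = 0 := by
  have h1 : inner ℂ s (T.starProjection s) = 0 := h s hs
  rw [← Submodule.starProjection_eq_self_iff.2 (T.starProjection_apply_mem s),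
    ← Submodule.inner_starProjection_left_eq_right] at h1
  exact inner_self_eq_zero.1 h1

omit [CompleteSpace H] in
/-- If `dim (S ∩ Tᗮ) < dim (T ∩ Sᗮ)`, the projection of `S` to `T` has a finite rank perturbation
that is injective and not surjective. -/
theorem exists_injective_not_surjective_perturbation {S T : Submodule ℂ H} [CompleteSpace S]
    [CompleteSpace T] (h : dim (S ⊓ Tᗮ) < dim (T ⊓ Sᗮ)) :
    ∃ J : S →L[ℂ] T, IsCompactOperator J ∧
      Function.Injective (T.orthogonalProjectionOnto ∘L S.subtypeL + J) ∧
      ¬ Function.Surjective (T.orthogonalProjectionOnto ∘L S.subtypeL + J) := by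
  obtain ⟨hfin, j, hj, v, hv⟩ := exists_injective_not_surjective_of_dim_lt h
  let i : (T ⊓ Sᗮ : Submodule ℂ H) →ₗ[ℂ] T := Submodule.inclusion inf_le_left
  let p : S →L[ℂ] (S ⊓ Tᗮ : Submodule ℂ H) :=
    (S ⊓ Tᗮ).orthogonalProjectionOnto ∘L S.subtypeL
  -- `J` sends the kernel `S ⊓ Tᗮ` of the projection into its defect `T ⊓ Sᗮ`, injectively but
  -- missing `v`.
  let J : S →L[ℂ] T := (i ∘ₗ j).toContinuousLinearMap ∘L p
  have hC : ∀ s : S, ((T.orthogonalProjectionOnto ∘L S.subtypeL + J) s : H) =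
      T.starProjection (s : H) + (j (p s) : H) := fun s => rfl
  -- The two summands decouple: if the sum lies in `Sᗮ`, so does `Q s`, and then `‖Q s‖² = ⟪s, Q s⟫
  -- = 0`.
  have key : ∀ (s : S) (w : (T ⊓ Sᗮ : Submodule ℂ H)),
      T.starProjection (s : H) + (j (p s) : H) = w → T.starProjection (s : H) = 0 ∧ j (p s) = w := by
    intro s w hw
    have h0 : T.starProjection (s : H) = 0 := by
      refine starProjection_eq_zero_of_mem_orthogonal s.2 ?_
      rw [eq_sub_of_add_eq hw]
      exact Sᗮ.sub_mem w.2.2 (j (p s)).2.2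
    exact ⟨h0, Subtype.ext (by rwa [h0, zero_add] at hw)⟩
  refine ⟨J, isCompactOperator_of_finiteDimensional_dom _ _ _, ?_, ?_⟩
  · rw [injective_iff_map_eq_zero]
    intro s hs
    have hs' := congrArg (Subtype.val : T → H) hs
    rw [hC] at hs'
    obtain ⟨h1, h2⟩ := key s 0 hs'
    have h3 : p s = 0 := hj (by rw [h2, map_zero])
    have h4 : (s : H) ∈ S ⊓ Tᗮ := ⟨s.2, (T.starProjection_apply_eq_zero_iff).1 h1⟩
    have h5 : ((p s : (S ⊓ Tᗮ : Submodule ℂ H)) : H) = s :=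
      Submodule.starProjection_eq_self_iff.2 h4
    rw [h3] at h5
    exact Subtype.ext h5.symm
  · intro hs
    obtain ⟨s, hs⟩ := hs (i v)
    have hs' := congrArg (Subtype.val : T → H) hs
    rw [hC] at hs'
    exact hv _ (key s v hs').2

/-- If `S` is compact relative to `T` and the two defect dimensions differ, then there is no common
complement. -/
theorem not_hasCommonComplement_of_isCompactOperator {S T : Submodule ℂ H} [CompleteSpace S]
    [CompleteSpace T] (hK : IsCompactOperator (Tᗮ.starProjection ∘L S.starProjection))
    (hdim : dim (S ⊓ Tᗮ) ≠ dim (Sᗮ ⊓ T)) : ¬ HasCommonComplement S T := by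
  rintro ⟨Z, hZ, hSZ, hTZ⟩
  have hTc : IsClosed (T : Set H) := (completeSpace_coe_iff_isComplete.1 ‹_›).isClosed
  have htop := Submodule.IsCompl.isTopCompl_of_isClosed hTZ hTc hZ
  let π : H →L[ℂ] T := T.projectionOntoL Z htop
  have hπT : ∀ t : T, π t = t := fun t => Submodule.projectionOnto_apply_left hTZ t
  have hπZ : ∀ x, π x = 0 ↔ x ∈ Z := fun x => Submodule.projectionOnto_apply_eq_zero_iff hTZ
  have hker : ((π ∘L S.subtypeL : S →L[ℂ] T) : S →ₗ[ℂ] T).ker = ⊥ := by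
    rw [LinearMap.ker_eq_bot']
    intro s hs
    have : (s : H) ∈ S ⊓ Z := ⟨s.2, (hπZ s).1 hs⟩
    rw [hSZ.inf_eq_bot] at this
    exact Subtype.ext this
  have hrange : ((π ∘L S.subtypeL : S →L[ℂ] T) : S →ₗ[ℂ] T).range = ⊤ := by
    rw [LinearMap.range_eq_top]
    intro t
    obtain ⟨s, hs, z, hz, hsz⟩ := Submodule.mem_sup.1
      (hSZ.sup_eq_top.symm ▸ Submodule.mem_top : (t : H) ∈ S ⊔ Z)
    refine ⟨⟨s, hs⟩, ?_⟩
    have := hπT t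
    rw [← hsz, map_add, (hπZ z).2 hz, add_zero] at this
    exact this
  let A : S ≃L[ℂ] T := ContinuousLinearEquiv.ofBijective (π ∘L S.subtypeL) hker hrange
  let P : S →L[ℂ] T := T.orthogonalProjectionOnto ∘L S.subtypeL
  have hA : (A : S →L[ℂ] T) = π ∘L S.subtypeL := rfl
  have hAP : IsCompactOperator ((A : S →L[ℂ] T) - P) := by
    have h1 : IsCompactOperator (π ∘L ((Tᗮ.starProjection ∘L S.starProjection) ∘L S.subtypeL)) :=
      (hK.comp_clm S.subtypeL).clm_comp π
    -- As `π` fixes `T`, on `S` one has `π - Q = π (1 - Q)`.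
    have h2 : (A : S →L[ℂ] T) - P =
        π ∘L ((Tᗮ.starProjection ∘L S.starProjection) ∘L S.subtypeL) := by
      refine ContinuousLinearMap.ext fun s => ?_
      change π s - P s = π (Tᗮ.starProjection (S.starProjection s))
      rw [Submodule.starProjection_eq_self_iff.2 s.2, Submodule.starProjection_orthogonal_val,
        map_sub]
      congr 1
      exact (hπT _).symm
    rw [h2]
    exact h1
  rw [inf_comm Sᗮ T] at hdim
  rcases lt_or_gt_of_ne hdim with hlt | hlt
  · obtain ⟨J, hJ, hinj, hsurj⟩ := exists_injective_not_surjective_perturbation hlt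
    refine hsurj (surjective_of_injective_of_isCompactOperator_sub A ?_ hinj)
    have := hAP.sub hJ
    rw [← sub_sub]
    exact this
  · obtain ⟨J, hJ, hinj, hsurj⟩ := exists_injective_not_surjective_perturbation hlt
    -- With the inequality reversed, the perturbed map is the projection `T → S`, the adjoint of
    -- `P`.
    let C : S →L[ℂ] T := P + J.adjoint
    have hC : C.adjoint = S.orthogonalProjectionOnto ∘L T.subtypeL + J := by
      simp only [C, P]
      rw [map_add, ContinuousLinearMap.adjoint_comp, ContinuousLinearMap.adjoint_adjoint,
        Submodule.adjoint_subtypeL, Submodule.adjoint_orthogonalProjectionOnto]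
    rw [← hC] at hinj hsurj
    refine hsurj (adjoint_surjective_of_injective_of_isCompactOperator_sub A ?_ hinj)
    have := hAP.sub (isCompactOperator_adjoint hJ)
    rw [← sub_sub]
    exact this

end Obstruction

/-! ### Spectral subspaces reducing both projections -/

section Reducing

variable {H : Type*} [NormedAddCommGroup H] [InnerProductSpace ℂ H]

/-- `L` reduces the orthogonal projection onto `S`. -/
def Reduces (L S : Submodule ℂ H) [S.HasOrthogonalProjection] : Prop :=
  (∀ x ∈ L, S.starProjection x ∈ L) ∧ ∀ x ∈ Lᗮ, S.starProjection x ∈ Lᗮ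

variable {L S T : Submodule ℂ H} [L.HasOrthogonalProjection] [S.HasOrthogonalProjection]
  [T.HasOrthogonalProjection]

theorem Reduces.starProjection_comm (h : Reduces L S) (x : H) :
    L.starProjection (S.starProjection x) = S.starProjection (L.starProjection x) := by
  refine Submodule.eq_starProjection_of_mem_orthogonal (h.1 _ (L.starProjection_apply_mem x)) ?_
  rw [← map_sub]
  exact h.2 _ (L.sub_starProjection_mem_orthogonal x)

theorem Reduces.starProjection_mem (h : Reduces L S) {x : H} (hx : x ∈ S) :
    L.starProjection x ∈ S := by
  rw [← Submodule.starProjection_eq_self_iff, ← h.starProjection_comm,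
    Submodule.starProjection_eq_self_iff.2 hx]

/-- On `S ⊓ Tᗮ` the difference of the projections is the identity. The part of such a vector in `Lᗮ`
stays in `S ⊓ Tᗮ`, so `δ < 1` kills it. -/
theorem inf_orthogonal_le_of_reduces (hS : Reduces L S) (hT : Reduces L T) {δ : ℝ} (hδ : δ < 1)
    (h : ∀ x ∈ Lᗮ, ‖S.starProjection x - T.starProjection x‖ ^ 2 ≤ δ * ‖x‖ ^ 2) :
    S ⊓ Tᗮ ≤ L := by
  intro x hx
  have h1 := h _ (L.sub_starProjection_mem_orthogonal x)
  have h2 : S.starProjection (x - L.starProjection x) = x - L.starProjection x :=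
    Submodule.starProjection_eq_self_iff.2 (S.sub_mem hx.1 (hS.starProjection_mem hx.1))
  have h3 : T.starProjection (x - L.starProjection x) = 0 := by
    rw [map_sub, ← hT.starProjection_comm, T.starProjection_apply_eq_zero_iff.2 hx.2, map_zero,
      sub_zero]
  rw [h2, h3, sub_zero] at h1
  have h4 : x - L.starProjection x = 0 := by
    rw [← norm_eq_zero, ← sq_eq_zero_iff]
    nlinarith [sq_nonneg ‖x - L.starProjection x‖]
  rw [sub_eq_zero.1 h4]
  exact L.starProjection_apply_mem x

theorem starProjection_mul_self (S : Submodule ℂ H) [S.HasOrthogonalProjection] :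
    S.starProjection * S.starProjection = S.starProjection := by
  ext x
  exact Submodule.starProjection_eq_self_iff.2 (S.starProjection_apply_mem x)

/-- The spectral subspace of `(P - Q) ^ 2` for the interval `(δ, ∞)`, where `P` and `Q` are the
projections onto `S` and `T`. -/
theorem exists_reduces_norm_sub_bounds [CompleteSpace H] (S T : Submodule ℂ H)
    [S.HasOrthogonalProjection] [T.HasOrthogonalProjection] (δ : ℝ) :
    ∃ L : Submodule ℂ H, IsClosed (L : Set H) ∧ Reduces L S ∧ Reduces L T ∧
      (∀ x ∈ L, δ * ‖x‖ ^ 2 ≤ ‖S.starProjection x - T.starProjection x‖ ^ 2) ∧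
      (∀ x ∈ Lᗮ, ‖S.starProjection x - T.starProjection x‖ ^ 2 ≤ δ * ‖x‖ ^ 2) := by
  set P := S.starProjection with hPdef
  set Q := T.starProjection with hQdef
  have hP : P * P = P := starProjection_mul_self S
  have hQ : Q * Q = Q := starProjection_mul_self T
  have hP' : ∀ x, P * (P * x) = P * x := fun x => by rw [← mul_assoc, hP]
  have hQ' : ∀ x, Q * (Q * x) = Q * x := fun x => by rw [← mul_assoc, hQ]
  have hPs : ∀ x y, inner ℂ (P x) y = inner ℂ x (P y) := S.inner_starProjection_left_eq_right
  have hQs : ∀ x y, inner ℂ (Q x) y = inner ℂ x (Q y) := T.inner_starProjection_left_eq_right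
  -- `(P - Q)²` commutes with `P` because both products equal `P - PQP`; likewise with `Q`.
  let a : H →L[ℂ] H := (P - Q) * (P - Q) - (δ : ℂ) • 1
  have hPa : Commute a P := by
    change _ * _ = _ * _
    simp only [a, mul_sub, sub_mul, mul_assoc, hP, hQ, hP', smul_mul_assoc, mul_smul_comm,
      one_mul, mul_one]
    abel
  have hQa : Commute a Q := by
    change _ * _ = _ * _
    simp only [a, mul_sub, sub_mul, mul_assoc, hP, hQ, hQ', smul_mul_assoc, mul_smul_comm,
      one_mul, mul_one]
    abel
  have hsa : IsSelfAdjoint a := by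
    refine IsSelfAdjoint.sub ?_ (IsSelfAdjoint.smul ?_ (IsSelfAdjoint.one _))
    · have := (isSelfAdjoint_starProjection S).sub (isSelfAdjoint_starProjection T)
      rw [IsSelfAdjoint, star_mul, this.star_eq]
    · rw [IsSelfAdjoint]; simp
  have hre : ∀ x, RCLike.re (inner ℂ (a x) x) = ‖P x - Q x‖ ^ 2 - δ * ‖x‖ ^ 2 := fun x => by
    have h1 : a x = P (P x - Q x) - Q (P x - Q x) - (δ : ℂ) • x := by simp [a]
    rw [h1, inner_sub_left, inner_sub_left, hPs, hQs, ← inner_sub_right,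
      inner_self_eq_norm_sq_to_K, inner_smul_left, inner_self_eq_norm_sq_to_K, map_sub]
    congr 1
    · norm_cast
    · rw [Complex.conj_ofReal]
      norm_cast
      exact (congrArg Complex.re (Complex.ofReal_mul δ (‖x‖ ^ 2)).symm).trans (Complex.ofReal_re _)
  have hpm : a⁺ - a⁻ = a := CFC.posPart_sub_negPart a hsa
  have h0 : a⁺ * a⁻ = 0 := CFC.posPart_mul_negPart a
  have hbp : a⁺.IsPositive := (ContinuousLinearMap.nonneg_iff_isPositive _).1 (CFC.posPart_nonneg a)
  have hbn : a⁻.IsPositive := (ContinuousLinearMap.nonneg_iff_isPositive _).1 (CFC.negPart_nonneg a)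
  have hbP : Commute a⁺ P := by rw [CFC.posPart_def]; exact hPa.cfcₙ_real _
  have hbQ : Commute a⁺ Q := by rw [CFC.posPart_def]; exact hQa.cfcₙ_real _
  have hax : ∀ x, a x = a⁺ x - a⁻ x := fun x => by rw [← sub_apply, hpm]
  generalize a⁺ = b at *
  generalize a⁻ = c at *
  -- The spectral subspace is `Nᗮ`, with `b = a⁺` and `c = a⁻`. Since `b c = 0`, `c` maps into `N`,
  -- so the form of `a` is that of `b` on `Nᗮ` and that of `-c` on `N`.
  let N : Submodule ℂ H := (b : H →ₗ[ℂ] H).ker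
  have hN : ∀ x, x ∈ N ↔ b x = 0 := fun x => Iff.rfl
  have hNc : IsClosed (N : Set H) := b.isClosed_ker
  have : CompleteSpace N := hNc.completeSpace_coe
  have hNN : Nᗮᗮ = N := N.orthogonal_orthogonal
  have hred : ∀ R : Submodule ℂ H, ∀ [R.HasOrthogonalProjection], Commute b R.starProjection →
      Reduces Nᗮ R := fun R _ hR => by
    have h1 : ∀ x ∈ N, R.starProjection x ∈ N := fun x hx => by
      have h2 := congrArg (fun f => f x) hR.eq
      rw [hN] at hx ⊢
      simpa [hx] using h2
    refine ⟨fun x hx n hn => ?_, by rwa [hNN]⟩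
    rw [← Submodule.inner_starProjection_left_eq_right]
    exact hx _ (h1 n hn)
  refine ⟨Nᗮ, N.isClosed_orthogonal, hred S hbP, hred T hbQ, fun x hx => ?_, fun x hx => ?_⟩
  · have h1 : c x ∈ N := by
      rw [hN]
      exact congrArg (fun f => f x) h0
    have h2 := hre x
    rw [hax, inner_sub_left, hx _ h1, sub_zero] at h2
    have h3 : 0 ≤ RCLike.re (inner ℂ (b x) x) := hbp.2 x
    linarith
  · rw [hNN, hN] at hx
    have h2 := hre x
    rw [hax, hx, zero_sub, inner_neg_left, map_neg] at h2
    have h3 : 0 ≤ RCLike.re (inner ℂ (c x) x) := hbn.2 x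
    linarith

end Reducing

/-! ### Constructing a common complement from an isometry on `L` -/

section Complement

variable {H : Type*} [NormedAddCommGroup H] [InnerProductSpace ℂ H]

/-- A continuous map that is bijective from `S` and from `T` onto the same subspace provides a
common complement. -/
theorem hasCommonComplement_of_bijOn {S T R : Submodule ℂ H} (W : H →L[ℂ] H) (hW : ∀ x, W x ∈ R)
    (hS : Set.BijOn W S R) (hT : Set.BijOn W T R) : HasCommonComplement S T := by
  have key : ∀ U : Submodule ℂ H, Set.BijOn W U R → IsCompl U (W : H →ₗ[ℂ] H).ker := by
    intro U hU
    refine ⟨Submodule.disjoint_def.2 fun x hx hx0 => ?_, codisjoint_iff.2 (eq_top_iff.2 ?_)⟩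
    · exact hU.injOn hx U.zero_mem (by rw [map_zero]; exact hx0)
    · intro x _
      obtain ⟨u, hu, hux⟩ := hU.surjOn (hW x)
      refine Submodule.mem_sup.2 ⟨u, hu, x - u, ?_, by abel⟩
      change W (x - u) = 0
      rw [map_sub, hux, sub_self]
  exact ⟨_, W.isClosed_ker, key S hS, key T hT⟩

/-- A bounded operator that is coercive on a closed invariant subspace is bijective there. -/
theorem bijOn_of_coercive {S : Submodule ℂ H} [CompleteSpace S] (A : H →L[ℂ] H)
    (hA : ∀ x ∈ S, A x ∈ S) {c : ℝ} (hc : 0 < c)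
    (h : ∀ x ∈ S, c * ‖x‖ ^ 2 ≤ RCLike.re (inner ℂ (A x) x)) : Set.BijOn A S S := by
  let B : S →L[ℂ] S := (A ∘L S.subtypeL).codRestrict S fun x => hA x x.2
  have hB : IsUnit B := B.isUnit_of_forall_le_norm_inner_map (c := ⟨c, hc.le⟩) hc fun x => by
    rw [mul_comm]
    exact (h x x.2).trans (RCLike.re_le_norm _)
  rw [ContinuousLinearMap.isUnit_iff_bijective] at hB
  refine ⟨hA, fun x hx y hy hxy => ?_, fun y hy => ?_⟩
  · exact congrArg Subtype.val (hB.1 (Subtype.ext hxy : B ⟨x, hx⟩ = B ⟨y, hy⟩))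
  · obtain ⟨x, hx⟩ := hB.2 ⟨y, hy⟩
    exact ⟨x, x.2, congrArg Subtype.val hx⟩

theorem coercive_of_block {L : Submodule ℂ H} {a b a' b' : H} (ha : a ∈ L) (hb : b ∈ Lᗮ)
    (ha' : a' ∈ L) (hb' : b' ∈ Lᗮ) {c : ℝ} (h1 : ‖(inner ℂ a' a : ℂ)‖ ≤ c * ‖a‖ ^ 2)
    (h2 : (1 - c) * ‖b‖ ^ 2 ≤ RCLike.re (inner ℂ b' b)) :
    (1 - c) * ‖a + b‖ ^ 2 ≤ RCLike.re (inner ℂ (a + a' + b') (a + b)) := by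
  have e1 : inner ℂ a b = 0 := hb a ha
  have e2 : inner ℂ a' b = 0 := hb a' ha'
  have e3 : inner ℂ b' a = 0 := inner_eq_zero_symm.1 (hb' a ha)
  have e4 : ‖a + b‖ ^ 2 = ‖a‖ ^ 2 + ‖b‖ ^ 2 := by
    rw [@norm_add_sq ℂ, e1]; simp
  have e5 : RCLike.re (inner ℂ a a) = ‖a‖ ^ 2 := inner_self_eq_norm_sq a
  simp only [inner_add_left, inner_add_right, map_add, e1, e2, e3, e5, map_zero]
  have := neg_le_of_abs_le ((RCLike.abs_re_le_norm (inner ℂ a' a)).trans h1)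
  rw [e4]
  linarith

theorem hasCommonComplement_of_reduces [CompleteSpace H] {S T L : Submodule ℂ H} [CompleteSpace S]
    [CompleteSpace T] [CompleteSpace L] (hS : Reduces L S) (hT : Reduces L T) {c : ℝ} (hc0 : 0 ≤ c) (hc : c < 1)
    (hSL : ∀ x ∈ S ⊓ L, ‖T.starProjection x‖ ≤ c * ‖x‖)
    (hTL : ∀ x ∈ T ⊓ L, ‖S.starProjection x‖ ≤ c * ‖x‖)
    (hSL' : ∀ x ∈ S ⊓ Lᗮ, (1 - c) * ‖x‖ ^ 2 ≤ ‖T.starProjection x‖ ^ 2)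
    (hTL' : ∀ x ∈ T ⊓ Lᗮ, (1 - c) * ‖x‖ ^ 2 ≤ ‖S.starProjection x‖ ^ 2)
    (U : (S ⊓ L : Submodule ℂ H) ≃ₗᵢ[ℂ] (T ⊓ L : Submodule ℂ H)) : HasCommonComplement S T := by
  have hclosed : ∀ R : Submodule ℂ H, CompleteSpace R → IsClosed (R : Set H) := fun R _ =>
    (completeSpace_coe_iff_isComplete.1 ‹_›).isClosed
  have hLc := hclosed L ‹_›
  have : CompleteSpace (S ⊓ L : Submodule ℂ H) :=
    ((hclosed S ‹_›).inter hLc).completeSpace_coe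
  have : CompleteSpace (T ⊓ L : Submodule ℂ H) :=
    ((hclosed T ‹_›).inter hLc).completeSpace_coe
  let V : H →L[ℂ] H := (T ⊓ L).subtypeL ∘L (U : (S ⊓ L : Submodule ℂ H) →L[ℂ] _) ∘L
    (S ⊓ L).orthogonalProjectionOnto
  let V' : H →L[ℂ] H := (S ⊓ L).subtypeL ∘L (U.symm : (T ⊓ L : Submodule ℂ H) →L[ℂ] _) ∘L
    (T ⊓ L).orthogonalProjectionOnto
  have hVmem : ∀ x, V x ∈ T ⊓ L := fun x => (U ((S ⊓ L).orthogonalProjectionOnto x)).2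
  have hV'mem : ∀ x, V' x ∈ S ⊓ L := fun x => (U.symm ((T ⊓ L).orthogonalProjectionOnto x)).2
  have hVx : ∀ x : (S ⊓ L : Submodule ℂ H), V x = U x := fun x => by simp [V]
  have hV'x : ∀ x : (T ⊓ L : Submodule ℂ H), V' x = U.symm x := fun x => by simp [V']
  have hV'V : ∀ x ∈ S ⊓ L, V' (V x) = x := fun x hx => by
    rw [hVx ⟨x, hx⟩, hV'x, U.symm_apply_apply]
  have hVV' : ∀ x ∈ T ⊓ L, V (V' x) = x := fun x hx => by
    rw [hV'x ⟨x, hx⟩, hVx, U.apply_symm_apply]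
  have hVnorm : ∀ x, ‖V x‖ ≤ ‖x‖ := fun x => by
    change ‖U ((S ⊓ L).orthogonalProjectionOnto x)‖ ≤ ‖x‖
    rw [U.norm_map]
    exact (S ⊓ L).norm_starProjection_apply_le x
  have hV0 : ∀ x ∈ Lᗮ, V x = 0 := fun x hx => by
    have : (S ⊓ L).orthogonalProjectionOnto x = 0 :=
      Submodule.orthogonalProjectionOnto_eq_zero_iff.2 (Submodule.orthogonal_le inf_le_right hx)
    simp [V, this]
  have hV'0 : ∀ x ∈ Lᗮ, V' x = 0 := fun x hx => by
    have : (T ⊓ L).orthogonalProjectionOnto x = 0 :=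
      Submodule.orthogonalProjectionOnto_eq_zero_iff.2 (Submodule.orthogonal_le inf_le_right hx)
    simp [V', this]
  have hV'norm : ∀ x, ‖V' x‖ ≤ ‖x‖ := fun x => by
    change ‖U.symm ((T ⊓ L).orthogonalProjectionOnto x)‖ ≤ ‖x‖
    rw [U.symm.norm_map]
    exact (T ⊓ L).norm_starProjection_apply_le x
  have hV'Q : ∀ x, V' (T.starProjection x) = V' x := fun x => by
    have : (T ⊓ L).orthogonalProjectionOnto (x - T.starProjection x) = 0 :=
      Submodule.orthogonalProjectionOnto_eq_zero_iff.2
        (Submodule.orthogonal_le inf_le_left (T.sub_starProjection_mem_orthogonal x))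
    rw [map_sub, sub_eq_zero] at this
    simp only [V', ContinuousLinearMap.comp_apply, this]
  clear_value V V'
  set P := S.starProjection with hPdef
  set Q := T.starProjection with hQdef
  have hPmem : ∀ x, P x ∈ S := S.starProjection_apply_mem
  have hQmem : ∀ x, Q x ∈ T := T.starProjection_apply_mem
  have hPid : ∀ x ∈ S, P x = x := fun x hx => Submodule.starProjection_eq_self_iff.2 hx
  have hQid : ∀ x ∈ T, Q x = x := fun x hx => Submodule.starProjection_eq_self_iff.2 hx
  have hPs : ∀ x y, inner ℂ (P x) y = inner ℂ x (P y) := S.inner_starProjection_left_eq_right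
  have hQs : ∀ x y, inner ℂ (Q x) y = inner ℂ x (Q y) := T.inner_starProjection_left_eq_right
  have hdec : ∀ R : Submodule ℂ H, ∀ [CompleteSpace R], Reduces L R → ∀ x ∈ R,
      ∃ a ∈ R ⊓ L, ∃ b ∈ R ⊓ Lᗮ, x = a + b := fun R _ hR x hx => by
    refine ⟨L.starProjection x, ⟨hR.starProjection_mem hx, L.starProjection_apply_mem x⟩,
      x - L.starProjection x, ⟨R.sub_mem hx (hR.starProjection_mem hx),
      L.sub_starProjection_mem_orthogonal x⟩, by abel⟩
  have hc' : 0 < 1 - c := by linarith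
  -- The complement is `ker W`. `Φ` is an approximate inverse `S → T`: `V` on `L`, `Q` on `Lᗮ`.
  -- Coercivity of `W Φ` on `S` and of `Φ W` on `T` makes `W` bijective from `T` onto `S`.
  let W : H →L[ℂ] H := P + V'
  let Φ : H →L[ℂ] H := V + Q - Q ∘L L.starProjection
  have hΦL : ∀ a ∈ L, Φ a = V a := fun a ha => by
    simp [Φ, Submodule.starProjection_eq_self_iff.2 ha]
  have hΦL' : ∀ b ∈ Lᗮ, Φ b = Q b := fun b hb => by
    simp [Φ, hV0 b hb, L.starProjection_apply_eq_zero_iff.2 hb]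
  have hWmem : ∀ x, W x ∈ S := fun x => S.add_mem (hPmem x) (hV'mem x).1
  have hΦmem : ∀ x, Φ x ∈ T := fun x =>
    T.sub_mem (T.add_mem (hVmem x).1 (hQmem x)) (hQmem _)
  have hW : Set.BijOn W S S := by
    refine bijOn_of_coercive W (fun x _ => hWmem x) hc' fun x hx => ?_
    obtain ⟨a, ha, b, hb, rfl⟩ := hdec S hS x hx
    have e : W (a + b) = a + V' a + b := by
      change P (a + b) + V' (a + b) = _
      rw [hPid _ hx, map_add, hV'0 b hb.2]
      abel
    rw [e]
    refine coercive_of_block ha.2 hb.2 (hV'mem a).2 hb.2 ?_ ?_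
    · refine (norm_inner_le_norm _ _).trans ?_
      have h1 : ‖V' a‖ ≤ c * ‖a‖ := by
        rw [← hV'Q]
        exact (hV'norm _).trans (hSL a ha)
      calc _ ≤ c * ‖a‖ * ‖a‖ := by gcongr
        _ = _ := by ring
    · rw [inner_self_eq_norm_sq]
      nlinarith [sq_nonneg ‖b‖]
  have hWΦ : Set.BijOn (W ∘L Φ) S S := by
    refine bijOn_of_coercive _ (fun x _ => hWmem _) hc' fun x hx => ?_
    obtain ⟨a, ha, b, hb, rfl⟩ := hdec S hS x hx
    have e : (W ∘L Φ) (a + b) = a + P (V a) + P (Q b) := by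
      change W (Φ (a + b)) = _
      rw [map_add, hΦL a ha.2, hΦL' b hb.2]
      change P (V a + Q b) + V' (V a + Q b) = _
      rw [map_add, map_add, hV'V a ha, hV'0 _ (hT.2 b hb.2)]
      abel
    rw [e]
    refine coercive_of_block ha.2 hb.2 (hS.1 _ (hVmem a).2) (hS.2 _ (hT.2 b hb.2)) ?_ ?_
    · refine (norm_inner_le_norm _ _).trans ?_
      have h1 := (hTL (V a) (hVmem a)).trans
        (mul_le_mul_of_nonneg_left (hVnorm a) hc0)
      calc _ ≤ c * ‖a‖ * ‖a‖ := by gcongr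
        _ = _ := by ring
    · rw [hPs, hPid b hb.1, ← hQid (Q b) (hQmem b), hQs, inner_self_eq_norm_sq]
      exact hSL' b hb
  have hΦW : Set.BijOn (Φ ∘L W) T T := by
    refine bijOn_of_coercive _ (fun x _ => hΦmem _) hc' fun x hx => ?_
    obtain ⟨a, ha, b, hb, rfl⟩ := hdec T hT x hx
    have e : (Φ ∘L W) (a + b) = a + V (P a) + Q (P b) := by
      change Φ (P (a + b) + V' (a + b)) = _
      rw [map_add, map_add, map_add, map_add, hV'0 b hb.2, map_add, map_zero, hΦL _ (hS.1 a ha.2),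
        hΦL' _ (hS.2 b hb.2), hΦL _ (hV'mem a).2, hVV' a ha]
      abel
    rw [e]
    refine coercive_of_block ha.2 hb.2 (hVmem _).2 (hT.2 _ (hS.2 b hb.2)) ?_ ?_
    · refine (norm_inner_le_norm _ _).trans ?_
      have h1 := (hVnorm (P a)).trans (hTL a ha)
      calc _ ≤ c * ‖a‖ * ‖a‖ := by gcongr
        _ = _ := by ring
    · rw [hQs, hQid b hb.1, ← hPid (P b) (hPmem b), hPs, inner_self_eq_norm_sq]
      exact hTL' b hb
  refine hasCommonComplement_of_bijOn W hWmem hW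
    ⟨fun x _ => hWmem x, fun x hx y hy hxy => hΦW.injOn hx hy (congrArg Φ hxy), fun y hy => ?_⟩
  obtain ⟨x, hx, hxy⟩ := hWΦ.surjOn hy
  exact ⟨Φ x, hΦmem x, hxy⟩

end Complement

/-! ### Existence of common complements -/

section Existence

variable {H : Type*} [NormedAddCommGroup H] [InnerProductSpace ℂ H]

theorem norm_starProjection_sq_of_mem {S T : Submodule ℂ H} [S.HasOrthogonalProjection]
    [T.HasOrthogonalProjection] {x : H} (hx : x ∈ S) :
    ‖T.starProjection x‖ ^ 2 = ‖x‖ ^ 2 - ‖S.starProjection x - T.starProjection x‖ ^ 2 := by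
  rw [Submodule.starProjection_eq_self_iff.2 hx, ← Submodule.starProjection_orthogonal_val,
    Submodule.norm_sq_eq_add_norm_sq_starProjection x T]
  ring

theorem hasCommonComplement_of_dim_inf_eq [CompleteSpace H] [TopologicalSpace.SeparableSpace H]
    {S T L : Submodule ℂ H} [CompleteSpace S] [CompleteSpace T] [CompleteSpace L]
    (hS : Reduces L S) (hT : Reduces L T) {δ : ℝ} (hδ0 : 0 < δ) (hδ1 : δ < 1)
    (hL : ∀ x ∈ L, δ * ‖x‖ ^ 2 ≤ ‖S.starProjection x - T.starProjection x‖ ^ 2)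
    (hL' : ∀ x ∈ Lᗮ, ‖S.starProjection x - T.starProjection x‖ ^ 2 ≤ δ * ‖x‖ ^ 2)
    (hdim : dim (S ⊓ L) = dim (T ⊓ L)) : HasCommonComplement S T := by
  have hclosed : ∀ R : Submodule ℂ H, CompleteSpace R → IsClosed (R : Set H) := fun R _ =>
    (completeSpace_coe_iff_isComplete.1 ‹_›).isClosed
  have hLc := hclosed L ‹_›
  have : CompleteSpace (S ⊓ L : Submodule ℂ H) :=
    ((hclosed S ‹_›).inter hLc).completeSpace_coe
  have : CompleteSpace (T ⊓ L : Submodule ℂ H) :=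
    ((hclosed T ‹_›).inter hLc).completeSpace_coe
  obtain ⟨U⟩ := nonempty_linearIsometryEquiv_of_dim_eq hdim
  have hsq : ∀ u v : ℝ, 0 ≤ u → 0 ≤ v → u ^ 2 ≤ (1 - δ) * v ^ 2 →
      u ≤ max √(1 - δ) δ * v := fun u v hu hv h => by
    refine le_trans ?_ (mul_le_mul_of_nonneg_right (le_max_left _ _) hv)
    refine le_of_sq_le_sq ?_ (by positivity)
    rwa [mul_pow, Real.sq_sqrt (by linarith)]
  -- `√(1 - δ)` bounds the projections on `L`; `δ` gives the lower bound `1 - δ ≥ 1 - c` on `Lᗮ`.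
  refine hasCommonComplement_of_reduces hS hT (c := max √(1 - δ) δ)
    (hδ0.le.trans (le_max_right _ _)) (max_lt ?_ hδ1) ?_ ?_ ?_ ?_ U
  · rw [Real.sqrt_lt' one_pos]; linarith
  · intro x hx
    refine hsq _ _ (norm_nonneg _) (norm_nonneg _) ?_
    rw [norm_starProjection_sq_of_mem hx.1]
    linarith [hL x hx.2]
  · intro x hx
    refine hsq _ _ (norm_nonneg _) (norm_nonneg _) ?_
    rw [norm_starProjection_sq_of_mem hx.1, norm_sub_rev]
    linarith [hL x hx.2]
  · intro x hx
    rw [norm_starProjection_sq_of_mem hx.1]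
    nlinarith [hL' x hx.2, mul_le_mul_of_nonneg_right (le_max_right √(1 - δ) δ) (sq_nonneg ‖x‖)]
  · intro x hx
    rw [norm_starProjection_sq_of_mem hx.1, norm_sub_rev]
    nlinarith [hL' x hx.2, mul_le_mul_of_nonneg_right (le_max_right √(1 - δ) δ) (sq_nonneg ‖x‖)]

/-- The map `Q + j p` from `S ⊓ L` to `T ⊓ L` is injective: its terms decouple, and `j` repairs the
kernel `S ⊓ Tᗮ` of `Q` on `S`. -/
theorem dim_inf_le_of_injective {S T L : Submodule ℂ H} [CompleteSpace T]
    [CompleteSpace (S ⊓ Tᗮ : Submodule ℂ H)]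
    (hT : Reduces L T) (hTL : T ⊓ Sᗮ ≤ L)
    (j : (S ⊓ Tᗮ : Submodule ℂ H) →ₗ[ℂ] (T ⊓ Sᗮ : Submodule ℂ H)) (hj : Function.Injective j) :
    dim (S ⊓ L) ≤ dim (T ⊓ L) := by
  let p := (S ⊓ Tᗮ).orthogonalProjectionOnto
  let f : (S ⊓ L : Submodule ℂ H) →ₗ[ℂ] H :=
    ((T.starProjection : H →ₗ[ℂ] H) + (T ⊓ Sᗮ).subtype ∘ₗ j ∘ₗ (p : H →ₗ[ℂ] _)) ∘ₗ (S ⊓ L).subtype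
  have hf : ∀ x, f x = T.starProjection (x : H) + (j (p x) : H) := fun x => rfl
  refine dim_le_of_injective (f.codRestrict (T ⊓ L) fun x => ?_) ?_
  · exact ⟨T.add_mem (T.starProjection_apply_mem _) (j (p x)).2.1,
      L.add_mem (hT.1 _ x.2.2) (hTL (j (p x)).2)⟩
  · refine (injective_iff_map_eq_zero _).2 fun x hx => ?_
    have hx' : T.starProjection (x : H) + (j (p x) : H) = 0 := congrArg Subtype.val hx
    have h0 : T.starProjection (x : H) = 0 := by
      refine starProjection_eq_zero_of_mem_orthogonal x.2.1 ?_
      rw [eq_neg_of_add_eq_zero_left hx']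
      exact Sᗮ.neg_mem (j (p x)).2.2
    have h1 : p x = 0 := hj (by
      rw [map_zero]
      exact Subtype.ext (by rwa [h0, zero_add] at hx'))
    have h2 : ((p x : (S ⊓ Tᗮ : Submodule ℂ H)) : H) = x :=
      Submodule.starProjection_eq_self_iff.2 ⟨x.2.1, T.starProjection_apply_eq_zero_iff.1 h0⟩
    rw [h1] at h2
    exact Subtype.ext h2.symm

/-- `Q` maps `S ⊓ L` into `T ⊓ L` with kernel inside `S ⊓ Tᗮ`. -/
theorem finiteDimensional_inf {S T L : Submodule ℂ H} [CompleteSpace T]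
    (hT : Reduces L T) [FiniteDimensional ℂ (S ⊓ Tᗮ : Submodule ℂ H)]
    [FiniteDimensional ℂ (T ⊓ L : Submodule ℂ H)] :
    FiniteDimensional ℂ (S ⊓ L : Submodule ℂ H) := by
  let p := (S ⊓ Tᗮ).orthogonalProjectionOnto
  let f : (S ⊓ L : Submodule ℂ H) →ₗ[ℂ] (T ⊓ L : Submodule ℂ H) :=
    ((T.starProjection : H →ₗ[ℂ] H) ∘ₗ (S ⊓ L).subtype).codRestrict (T ⊓ L) fun x =>
      ⟨T.starProjection_apply_mem _, hT.1 _ x.2.2⟩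
  let g : (S ⊓ L : Submodule ℂ H) →ₗ[ℂ] (S ⊓ Tᗮ : Submodule ℂ H) :=
    (p : H →ₗ[ℂ] _) ∘ₗ (S ⊓ L).subtype
  refine Module.Finite.of_injective (f.prod g) ((injective_iff_map_eq_zero _).2 fun x hx => ?_)
  have h0 : T.starProjection (x : H) = 0 := congrArg (fun y => ((y.1 : (T ⊓ L : Submodule ℂ H)) : H)) hx
  have h1 : p x = 0 := congrArg Prod.snd hx
  have h2 : ((p x : (S ⊓ Tᗮ : Submodule ℂ H)) : H) = x :=
    Submodule.starProjection_eq_self_iff.2 ⟨x.2.1, T.starProjection_apply_eq_zero_iff.1 h0⟩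
  rw [h1] at h2
  exact Subtype.ext h2.symm

variable [CompleteSpace H]

theorem hasCommonComplement_of_dim_eq [TopologicalSpace.SeparableSpace H]
    {S T : Submodule ℂ H} [CompleteSpace S] [CompleteSpace T]
    (h : dim (S ⊓ Tᗮ) = dim (T ⊓ Sᗮ)) : HasCommonComplement S T := by
  have hclosed : ∀ R : Submodule ℂ H, CompleteSpace R → IsClosed (R : Set H) := fun R _ =>
    (completeSpace_coe_iff_isComplete.1 ‹_›).isClosed
  have : CompleteSpace (S ⊓ Tᗮ : Submodule ℂ H) :=
    ((hclosed S ‹_›).inter T.isClosed_orthogonal).completeSpace_coe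
  have : CompleteSpace (T ⊓ Sᗮ : Submodule ℂ H) :=
    ((hclosed T ‹_›).inter S.isClosed_orthogonal).completeSpace_coe
  obtain ⟨U⟩ := nonempty_linearIsometryEquiv_of_dim_eq h
  obtain ⟨L, hLc, hS, hT, hL, hL'⟩ := exists_reduces_norm_sub_bounds S T (1 / 2)
  have : CompleteSpace L := hLc.completeSpace_coe
  refine hasCommonComplement_of_dim_inf_eq hS hT (by norm_num) (by norm_num) hL hL'
    (le_antisymm ?_ ?_)
  · exact dim_inf_le_of_injective hT
      (inf_orthogonal_le_of_reduces hT hS (δ := 1 / 2) (by norm_num)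
        fun x hx => by rw [norm_sub_rev]; exact hL' x hx)
      (U.toLinearEquiv : _ →ₗ[ℂ] _) U.injective
  · exact dim_inf_le_of_injective hS
      (inf_orthogonal_le_of_reduces hS hT (δ := 1 / 2) (by norm_num) hL')
      (U.symm.toLinearEquiv : _ →ₗ[ℂ] _) U.symm.injective

theorem hasCommonComplement_of_not_isCompactOperator [TopologicalSpace.SeparableSpace H]
    {S T : Submodule ℂ H} [CompleteSpace S] [CompleteSpace T]
    [FiniteDimensional ℂ (S ⊓ Tᗮ : Submodule ℂ H)]
    (h : ¬ IsCompactOperator (Tᗮ.starProjection ∘L S.starProjection)) :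
    HasCommonComplement S T := by
  by_contra hno
  refine h (isCompactOperator_of_forall_exists_norm_sub_le fun ε hε => ?_)
  -- `δ < ε²` since on `S ⊓ Lᗮ` the bound for `(P - Q)²` reads `‖(1 - Q)y‖² ≤ δ ‖y‖²`.
  obtain ⟨δ, hδ0, hδ⟩ := exists_between (lt_min (sq_pos_of_pos hε) one_pos)
  obtain ⟨hδε, hδ1⟩ := lt_min_iff.1 hδ
  obtain ⟨L, hLc, hS, hT, hL, hL'⟩ := exists_reduces_norm_sub_bounds S T δ
  have : CompleteSpace L := hLc.completeSpace_coe
  have hfin : FiniteDimensional ℂ (S ⊓ L : Submodule ℂ H) := by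
    by_contra hinf
    have hinf' : ¬ FiniteDimensional ℂ (T ⊓ L : Submodule ℂ H) := fun _ =>
      hinf (finiteDimensional_inf hT)
    -- Both dimensions are `⊤`, hence equal.
    refine hno (hasCommonComplement_of_dim_inf_eq hS hT hδ0 hδ1 hL hL' ?_)
    rw [← dim_lt_top_iff, not_lt_top_iff] at hinf hinf'
    rw [hinf, hinf']
  refine ⟨(Tᗮ.starProjection ∘L S.starProjection) ∘L L.starProjection, ?_, fun x => ?_⟩
  · have hmem : ∀ x, (S.starProjection ∘L L.starProjection) x ∈ S ⊓ L := fun x =>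
      ⟨S.starProjection_apply_mem _, hS.1 _ (L.starProjection_apply_mem x)⟩
    exact (isCompactOperator_of_finiteDimensional_range hmem).clm_comp Tᗮ.starProjection
  · set y := x - L.starProjection x with hy
    have h1 : (Tᗮ.starProjection ∘L S.starProjection) x -
        ((Tᗮ.starProjection ∘L S.starProjection) ∘L L.starProjection) x =
        Tᗮ.starProjection (S.starProjection y) := by
      simp only [ContinuousLinearMap.comp_apply, hy, map_sub]
    have hyL : S.starProjection y ∈ Lᗮ := hS.2 _ (L.sub_starProjection_mem_orthogonal x)
    have hyx : ‖S.starProjection y‖ ≤ ‖x‖ := by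
      refine (S.norm_starProjection_apply_le y).trans ?_
      rw [hy, ← Submodule.starProjection_orthogonal_val]
      exact Lᗮ.norm_starProjection_apply_le x
    have h2 := hL' _ hyL
    rw [Submodule.starProjection_eq_self_iff.2 (S.starProjection_apply_mem y),
      ← Submodule.starProjection_orthogonal_val] at h2
    rw [h1]
    refine le_of_sq_le_sq ?_ (by positivity)
    rw [mul_pow]
    exact h2.trans (by gcongr)

end Existence

end CommonComplement

/-! ### The two equivalences -/

theorem mainTheorem11 {H : Type*} [NormedAddCommGroup H] [InnerProductSpace ℂ H]
    [CompleteSpace H] [TopologicalSpace.SeparableSpace H]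
    (S T : Submodule ℂ H) (hS : IsClosed (S : Set H)) (hT : IsClosed (T : Set H)) :
    (¬ CommonComplement.HasCommonComplement S T ↔
      CommonComplement.dim (S ⊓ Tᗮ) ≠ CommonComplement.dim (Sᗮ ⊓ T) ∧
      (CommonComplement.dim (S ⊓ Tᗮ) < ⊤ → CommonComplement.HasBiorthogonalBases S Tᗮ) ∧
      (CommonComplement.dim (Sᗮ ⊓ T) < ⊤ → CommonComplement.HasBiorthogonalBases Sᗮ T)) ∧
    (¬ CommonComplement.HasCommonComplement S T ↔
      CommonComplement.dim (S ⊓ Tᗮ) ≠ CommonComplement.dim (Sᗮ ⊓ T) ∧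
      ((CommonComplement.dim (S ⊓ Tᗮ) < ⊤ ∧ CommonComplement.HasBiorthogonalBases S Tᗮ) ∨
       (CommonComplement.dim (Sᗮ ⊓ T) < ⊤ ∧ CommonComplement.HasBiorthogonalBases Sᗮ T))) := by
  have := hS.completeSpace_coe
  have := hT.completeSpace_coe
  -- Exchanging `S` and `T` reduces the pair `Sᗮ`, `T` to the first pair.
  have swap : ∀ {A B : Submodule ℂ H}, CommonComplement.HasCommonComplement A B →
      CommonComplement.HasCommonComplement B A := fun ⟨Z, hZ, h1, h2⟩ => ⟨Z, hZ, h2, h1⟩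
  have hne : ¬ CommonComplement.HasCommonComplement S T →
      CommonComplement.dim (S ⊓ Tᗮ) ≠ CommonComplement.dim (Sᗮ ⊓ T) := fun h heq =>
    h (CommonComplement.hasCommonComplement_of_dim_eq (by rw [heq, inf_comm]))
  have h1 : ¬ CommonComplement.HasCommonComplement S T →
      CommonComplement.dim (S ⊓ Tᗮ) < ⊤ → CommonComplement.HasBiorthogonalBases S Tᗮ := by
    intro h hfin
    have := CommonComplement.dim_lt_top_iff.1 hfin
    rw [CommonComplement.hasBiorthogonalBases_iff_isCompactOperator]
    by_contra hc
    exact h (CommonComplement.hasCommonComplement_of_not_isCompactOperator hc)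
  have h2 : ¬ CommonComplement.HasCommonComplement S T →
      CommonComplement.dim (Sᗮ ⊓ T) < ⊤ → CommonComplement.HasBiorthogonalBases Sᗮ T := by
    intro h hfin
    rw [inf_comm] at hfin
    have := CommonComplement.dim_lt_top_iff.1 hfin
    rw [CommonComplement.hasBiorthogonalBases_comm,
      CommonComplement.hasBiorthogonalBases_iff_isCompactOperator]
    by_contra hc
    exact h (swap (CommonComplement.hasCommonComplement_of_not_isCompactOperator hc))
  have h3 : CommonComplement.dim (S ⊓ Tᗮ) ≠ CommonComplement.dim (Sᗮ ⊓ T) →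
      CommonComplement.HasBiorthogonalBases S Tᗮ → ¬ CommonComplement.HasCommonComplement S T :=
    fun hd hb => CommonComplement.not_hasCommonComplement_of_isCompactOperator
      hb.isCompactOperator hd
  have h4 : CommonComplement.dim (S ⊓ Tᗮ) ≠ CommonComplement.dim (Sᗮ ⊓ T) →
      CommonComplement.HasBiorthogonalBases Sᗮ T → ¬ CommonComplement.HasCommonComplement S T :=
    fun hd hb hc => CommonComplement.not_hasCommonComplement_of_isCompactOperator
      hb.symm.isCompactOperator (by rw [inf_comm, inf_comm Tᗮ]; exact hd.symm) (swap hc)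
  -- Distinct dimensions are not both `⊤`, so at least one of the two implications is not vacuous.
  have hlt : CommonComplement.dim (S ⊓ Tᗮ) ≠ CommonComplement.dim (Sᗮ ⊓ T) →
      CommonComplement.dim (S ⊓ Tᗮ) < ⊤ ∨ CommonComplement.dim (Sᗮ ⊓ T) < ⊤ := fun hd =>
    (lt_or_gt_of_ne hd).imp (fun h => h.trans_le le_top) (fun h => h.trans_le le_top)
  refine ⟨⟨fun h => ⟨hne h, h1 h, h2 h⟩, fun ⟨hd, ha, hb⟩ => ?_⟩,
    ⟨fun h => ⟨hne h, ?_⟩, fun ⟨hd, hab⟩ => ?_⟩⟩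
  · exact (hlt hd).elim (fun h => h3 hd (ha h)) (fun h => h4 hd (hb h))
  · exact (hlt (hne h)).imp (fun hl => ⟨hl, h1 h hl⟩) (fun hl => ⟨hl, h2 h hl⟩)
  · exact hab.elim (fun h => h3 hd h.2) (fun h => h4 hd h.2)
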